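/- Notation. For a complex matrix $A$, $\|A\|_\infty$ is its operator norm with respect to the Euclidean norms. $\mathcal A_n$ is the C*-algebra $(\mathbb C^n,\|\cdot\|_\infty)$, and $\Delta_n(\xi)$ is the diagonal matrix with diagonal $\xi$. For a complex $m\times n$ matrix $X$, $\|X\|_{cbF}$ is the completely bounded norm of the operator $F_X:\mathcal A_n\to\mathbb C^m$ with matrix $X$, where $\mathbb C^m=M_{(m,1)}(\mathbb C)$ is the column Hilbert space, and $\|X\|_{cbB}$ is the completely bounded norm, in the sense of Christensen and Sinclair, of the bilinear form $B_X(a,b)=\sum_{i,j}a_iX_{(i,j)}b_j$ on $\mathcal A_m\times\mathcal A_n$. A positive unit vector is a vector with non-negative entries and Euclidean norm $1$. A cbF-factorization of $X$ is a factorization $X=A\Delta_n(\xi)$ with $\xi$ a positive unit vector in $\mathbb C^n$ and $\|A\|_\infty=\|X\|_{cbF}$. A cbB-factorization of $X$ is a factorization $X=\Delta_m(\eta)B\Delta_n(\xi)$ with $\eta\in\mathbb C^m$, $\xi\in\mathbb C^n$ positive unit vectors and $\|B\|_\infty=\|X\|_{cbB}$. Theorem. Let $X$ be a complex $m\times n$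 matrix with cbB-factorization $X=\Delta_m(\eta)B\Delta_n(\xi)$, and let $B=WP$ be the polar decomposition of $B$ (so $P$ is the positive square root of $B^*B$ and $W$ is a partial isometry with the same kernel as $P$). Then the $n\times n$ matrix $C:=P^{1/2}\Delta_n(\xi)$ and the $m\times n$ matrix $D:=\Delta_m(\eta)WP^{1/2}$ satisfy: (i) $X=DC$. (ii) $\|D^*\|_{cbF}=\|X\|_{cbB}^{1/2}$, and $D^*=(P^{1/2}W^*)\Delta_m(\eta)$ is a cbF-factorization of $D^*$. (iii) $\|C\|_{cbF}=\|X\|_{cbB}^{1/2}$, and $C=P^{1/2}\Delta_n(\xi)$ is a cbF-factorization of $C$. -/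

import Mathlib

open scoped Matrix ComplexOrder MatrixOrder Matrix.Norms.L2Operator

noncomputable section

namespace CbMatrix

/-! Throughout, `‖A‖` for a complex matrix `A` is its operator norm with respect to the Euclidean
norms, and `𝒜_n` is the abelian C*-algebra `Fin n → ℂ` with pointwise product and sup norm. -/

/-- The C*-norm of `M_k(𝒜_n)`: the algebra of `k × k` matrices over `𝒜_n` is the direct sum of
`n` copies of `M_k(ℂ)`, one for each of the `n` points. -/
def ampNorm {k n : ℕ} (a : Matrix (Fin k) (Fin k) (Fin n → ℂ)) : ℝ :=
  ⨆ j : Fin n, ‖a.map (fun f => f j)‖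

/-- The `k`-th amplification of a linear map `u` from `𝒜_n` to the column Hilbert space
`M_{m,1}(ℂ)`: apply `u` entrywise and identify `M_k(M_{m,1}(ℂ))` with `M_{km,k}(ℂ)`. -/
def ampCol {m n : ℕ} (u : (Fin n → ℂ) →ₗ[ℂ] (Fin m → ℂ)) {k : ℕ}
    (a : Matrix (Fin k) (Fin k) (Fin n → ℂ)) : Matrix (Fin k × Fin m) (Fin k) ℂ :=
  Matrix.of fun p t => u (a p.1 t) p.2

/-- The completely bounded norm of a linear map from `𝒜_n` to the column Hilbert space of
dimension `m`: the supremum over `k` of the norms of its amplifications. -/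
def cbNormCol {m n : ℕ} (u : (Fin n → ℂ) →ₗ[ℂ] (Fin m → ℂ)) : ℝ :=
  sSup {r : ℝ | ∃ (k : ℕ) (a : Matrix (Fin k) (Fin k) (Fin n → ℂ)),
    ampNorm a ≤ 1 ∧ r = ‖ampCol u a‖}

/-- The `k`-th amplification of a bilinear form on `𝒜_m × 𝒜_n` (in the sense of Christensen and
Sinclair), a bilinear map `M_k(𝒜_m) × M_k(𝒜_n) → M_k(ℂ)`. -/
def ampBil {m n : ℕ} (β : (Fin m → ℂ) →ₗ[ℂ] (Fin n → ℂ) →ₗ[ℂ] ℂ) {k : ℕ}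
    (a : Matrix (Fin k) (Fin k) (Fin m → ℂ)) (b : Matrix (Fin k) (Fin k) (Fin n → ℂ)) :
    Matrix (Fin k) (Fin k) ℂ :=
  Matrix.of fun s t => ∑ r, β (a s r) (b r t)

/-- The completely bounded norm of a bilinear form on `𝒜_m × 𝒜_n`: the supremum over `k` of the
norms of its amplifications. -/
def cbNormBil {m n : ℕ} (β : (Fin m → ℂ) →ₗ[ℂ] (Fin n → ℂ) →ₗ[ℂ] ℂ) : ℝ :=
  sSup {r : ℝ | ∃ (k : ℕ) (a : Matrix (Fin k) (Fin k) (Fin m → ℂ))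
    (b : Matrix (Fin k) (Fin k) (Fin n → ℂ)),
    ampNorm a ≤ 1 ∧ ampNorm b ≤ 1 ∧ r = ‖ampBil β a b‖}

/-- `‖X‖_cbF`: the completely bounded norm of the operator `F_X : 𝒜_n → ℂ^m` with matrix `X`. -/
def cbF {m n : ℕ} (X : Matrix (Fin m) (Fin n) ℂ) : ℝ :=
  cbNormCol (Matrix.mulVecLin X)

/-- `‖X‖_cbB`: the completely bounded norm of the bilinear form
`B_X(a, b) = ∑ i, ∑ j, a i * X i j * b j` on `𝒜_m × 𝒜_n`. -/
def cbB {m n : ℕ} (X : Matrix (Fin m) (Fin n) ℂ) : ℝ :=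
  cbNormBil (Matrix.toLinearMap₂' ℂ X)

/-- The diagonal matrix `Δ(ξ)` of a real vector `ξ`, as a complex matrix. -/
def Δ {n : ℕ} (ξ : Fin n → ℝ) : Matrix (Fin n) (Fin n) ℂ :=
  Matrix.diagonal fun j => (ξ j : ℂ)

/-- A unit vector for the Euclidean norm with non-negative entries. -/
def IsPosUnit {n : ℕ} (ξ : Fin n → ℝ) : Prop :=
  (∀ j, 0 ≤ ξ j) ∧ ∑ j, ξ j ^ 2 = 1

/-- `X = A Δ(ξ)` is a cbF-factorization of `X`. -/
structure IsCbFFactorization {m n : ℕ} (X A : Matrix (Fin m) (Fin n) ℂ) (ξ : Fin n → ℝ) :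
    Prop where
  unit : IsPosUnit ξ
  eq : X = A * Δ ξ
  norm_eq : ‖A‖ = cbF X

/-- `X = Δ(η) B Δ(ξ)` is a cbB-factorization of `X`. -/
structure IsCbBFactorization {m n : ℕ} (X : Matrix (Fin m) (Fin n) ℂ) (η : Fin m → ℝ)
    (B : Matrix (Fin m) (Fin n) ℂ) (ξ : Fin n → ℝ) : Prop where
  unit_left : IsPosUnit η
  unit_right : IsPosUnit ξ
  eq : X = Δ η * B * Δ ξ
  norm_eq : ‖B‖ = cbB X

/-- `B = W P` is the polar decomposition of `B`: `P` is positive semidefinite and `W` is a partial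
isometry with the same kernel as `P`; then `P` is the square root of `Bᴴ * B`. -/
structure IsPolarDecomposition {m n : ℕ} (B W : Matrix (Fin m) (Fin n) ℂ)
    (P : Matrix (Fin n) (Fin n) ℂ) : Prop where
  pos : P.PosSemidef
  partialIsometry : W * Wᴴ * W = W
  ker_eq : ∀ v : Fin n → ℂ, W *ᵥ v = 0 ↔ P *ᵥ v = 0
  eq : B = W * P

end CbMatrix

end

namespace CbMatrix

section Euclidean

variable {ι κ : Type*} [Fintype ι] [Fintype κ] [DecidableEq κ]

/-! Put s = ‖X‖_cbB^{1/2} = ‖B‖^{1/2}. By the C*-identity and since W*W fixes the range of P, both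
P^{1/2} and P^{1/2}W* have norm s. A factor AΔ(ξ) satisfies ‖AΔ(ξ)‖_cbF ≤ ‖A‖
(`cbF_mul_diagonal_le`), so C and D* have cbF-norm at most s. Conversely, X = DC splits each
amplification of B_X into a product of column amplifications, whence s² ≤ ‖D*‖_cbF ‖C‖_cbF
(`cbB_mul_le`). Two numbers in [0, s] with product at least s² both equal s. -/

theorem sum_norm_sq_mulVec_le (A : Matrix ι κ ℂ) (v : κ → ℂ) :
    ∑ i, ‖(A *ᵥ v) i‖ ^ 2 ≤ ‖A‖ ^ 2 * ∑ j, ‖v j‖ ^ 2 := by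
  have h := Matrix.l2_opNorm_mulVec A (WithLp.toLp 2 v)
  have h2 := pow_le_pow_left₀ (norm_nonneg _) h 2
  rw [mul_pow, EuclideanSpace.norm_sq_eq, EuclideanSpace.norm_sq_eq] at h2
  simpa using h2

theorem l2_opNorm_le_of_sum_norm_sq_le (A : Matrix ι κ ℂ) {c : ℝ} (hc : 0 ≤ c)
    (h : ∀ v : κ → ℂ, ∑ i, ‖(A *ᵥ v) i‖ ^ 2 ≤ c ^ 2 * ∑ j, ‖v j‖ ^ 2) : ‖A‖ ≤ c := by
  rw [Matrix.l2_opNorm_def]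
  refine ContinuousLinearMap.opNorm_le_bound _ hc fun v => ?_
  refine le_of_sq_le_sq ?_ (by positivity)
  rw [mul_pow, EuclideanSpace.norm_sq_eq, EuclideanSpace.norm_sq_eq]
  simpa using h v.ofLp

end Euclidean

variable {m n k : ℕ}

theorem norm_map_le_ampNorm (a : Matrix (Fin k) (Fin k) (Fin n → ℂ)) (j : Fin n) :
    ‖a.map (fun f => f j)‖ ≤ ampNorm a :=
  le_ciSup (f := fun j : Fin n => ‖a.map (fun f => f j)‖) (Set.finite_range _).bddAbove j

theorem ampNorm_conjTranspose (a : Matrix (Fin k) (Fin k) (Fin n → ℂ)) :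
    ampNorm aᴴ = ampNorm a := by
  unfold ampNorm
  refine congrArg _ (funext fun j => ?_)
  rw [← Matrix.l2_opNorm_conjTranspose (a.map fun f => f j)]
  rfl

/-- The r-th block of the amplification applied to v is A y_r, with y_r(j) = ξ_j (a_j v)_r. Each a_j
is a contraction, so the y_r have total square norm at most Σ ξ_j² ‖v‖² = ‖v‖². -/
theorem norm_ampCol_le (A : Matrix (Fin m) (Fin n) ℂ) {ξ : Fin n → ℝ} (hξ : IsPosUnit ξ)
    (a : Matrix (Fin k) (Fin k) (Fin n → ℂ)) (ha : ampNorm a ≤ 1) :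
    ‖ampCol (Matrix.mulVecLin (A * Δ ξ)) a‖ ≤ ‖A‖ := by
  refine l2_opNorm_le_of_sum_norm_sq_le _ (norm_nonneg _) fun v => ?_
  set y : Fin k → Fin n → ℂ := fun r j => (ξ j : ℂ) * (a.map (fun f => f j) *ᵥ v) r with hy
  have key (p : Fin k × Fin m) :
      (ampCol (Matrix.mulVecLin (A * Δ ξ)) a *ᵥ v) p = (A *ᵥ y p.1) p.2 := by
    simp only [ampCol, Δ, hy, Matrix.mulVec, dotProduct, Matrix.of_apply, Matrix.mulVecLin_apply,
      Matrix.mul_diagonal, Matrix.map_apply, Finset.sum_mul, Finset.mul_sum]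
    rw [Finset.sum_comm]
    exact Finset.sum_congr rfl fun _ _ => Finset.sum_congr rfl fun _ _ => by ring
  have hj (j : Fin n) : ∑ r, ‖(a.map (fun f => f j) *ᵥ v) r‖ ^ 2 ≤ ∑ t, ‖v t‖ ^ 2 := by
    refine (sum_norm_sq_mulVec_le _ v).trans (mul_le_of_le_one_left (by positivity) ?_)
    exact pow_le_one₀ (norm_nonneg _) ((norm_map_le_ampNorm a j).trans ha)
  simp only [key]
  rw [Fintype.sum_prod_type]
  calc ∑ r, ∑ l, ‖(A *ᵥ y r) l‖ ^ 2
      ≤ ∑ r, ‖A‖ ^ 2 * ∑ j, ‖y r j‖ ^ 2 :=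
        Finset.sum_le_sum fun r _ => sum_norm_sq_mulVec_le A (y r)
    _ = ‖A‖ ^ 2 * ∑ j, ξ j ^ 2 * ∑ r, ‖(a.map (fun f => f j) *ᵥ v) r‖ ^ 2 := by
        rw [← Finset.mul_sum, Finset.sum_comm]
        simp only [hy, norm_mul, mul_pow, Complex.norm_real, Real.norm_eq_abs, sq_abs,
          Finset.mul_sum]
    _ ≤ ‖A‖ ^ 2 * ∑ j, ξ j ^ 2 * ∑ t, ‖v t‖ ^ 2 := by
        gcongr ‖A‖ ^ 2 * ?_
        exact Finset.sum_le_sum fun j _ => mul_le_mul_of_nonneg_left (hj j) (sq_nonneg _)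
    _ = ‖A‖ ^ 2 * ∑ t, ‖v t‖ ^ 2 := by rw [← Finset.sum_mul, hξ.2, one_mul]

theorem cbF_nonneg (X : Matrix (Fin m) (Fin n) ℂ) : 0 ≤ cbF X :=
  Real.sSup_nonneg (by rintro _ ⟨k, a, -, rfl⟩; exact norm_nonneg _)

theorem cbF_mul_diagonal_le (A : Matrix (Fin m) (Fin n) ℂ) {ξ : Fin n → ℝ} (hξ : IsPosUnit ξ) :
    cbF (A * Δ ξ) ≤ ‖A‖ :=
  Real.sSup_le (by rintro _ ⟨k, a, ha, rfl⟩; exact norm_ampCol_le A hξ a ha) (norm_nonneg _)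

/-- The factorization supplies the upper bound that `le_csSup` needs; the real `sSup` of an
unbounded set would be 0. -/
theorem norm_ampCol_le_cbF (A : Matrix (Fin m) (Fin n) ℂ) {ξ : Fin n → ℝ} (hξ : IsPosUnit ξ)
    (a : Matrix (Fin k) (Fin k) (Fin n → ℂ)) (ha : ampNorm a ≤ 1) :
    ‖ampCol (Matrix.mulVecLin (A * Δ ξ)) a‖ ≤ cbF (A * Δ ξ) :=
  le_csSup ⟨‖A‖, by rintro _ ⟨k, a, ha, rfl⟩; exact norm_ampCol_le A hξ a ha⟩ ⟨k, a, ha, rfl⟩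

/-- The (s, t) entry is Σ_r a(s,r)ᵀ D C b(r,t): a row block built from D meets a column block built
from C, and the row is the adjoint of a column for Dᴴ. -/
theorem ampBil_mul {l : ℕ} (D : Matrix (Fin m) (Fin l) ℂ) (C : Matrix (Fin l) (Fin n) ℂ)
    (a : Matrix (Fin k) (Fin k) (Fin m → ℂ)) (b : Matrix (Fin k) (Fin k) (Fin n → ℂ)) :
    ampBil (Matrix.toLinearMap₂' ℂ (D * C)) a b =
      (ampCol (Matrix.mulVecLin Dᴴ) aᴴ)ᴴ * ampCol (Matrix.mulVecLin C) b := by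
  have hD (f : Fin m → ℂ) (i : Fin l) : star ((Dᴴ *ᵥ star f) i) = (f ᵥ* D) i := by
    rw [← Matrix.star_vecMul, Pi.star_apply, star_star]
  ext s t
  rw [Matrix.mul_apply, Fintype.sum_prod_type]
  refine (Finset.sum_congr rfl fun r _ => ?_ :
    ∑ r, Matrix.toLinearMap₂' ℂ (D * C) (a s r) (b r t) = _)
  rw [Matrix.toLinearMap₂'_apply', ← Matrix.mulVec_mulVec, Matrix.dotProduct_mulVec, dotProduct]
  refine Finset.sum_congr rfl fun i _ => ?_
  exact congrArg (· * (C *ᵥ b r t) i) (hD (a s r) i).symm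

theorem cbB_mul_le {l : ℕ} (A' : Matrix (Fin l) (Fin m) ℂ) {η : Fin m → ℝ} (hη : IsPosUnit η)
    (A : Matrix (Fin l) (Fin n) ℂ) {ξ : Fin n → ℝ} (hξ : IsPosUnit ξ) :
    cbB ((A' * Δ η)ᴴ * (A * Δ ξ)) ≤ cbF (A' * Δ η) * cbF (A * Δ ξ) := by
  refine Real.sSup_le ?_ (mul_nonneg (cbF_nonneg _) (cbF_nonneg _))
  rintro _ ⟨k, a, b, ha, hb, rfl⟩
  rw [ampBil_mul, Matrix.conjTranspose_conjTranspose]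
  refine (Matrix.l2_opNorm_mul _ _).trans ?_
  rw [Matrix.l2_opNorm_conjTranspose]
  exact mul_le_mul (norm_ampCol_le_cbF A' hη _ ((ampNorm_conjTranspose a).trans_le ha))
    (norm_ampCol_le_cbF A hξ b hb) (norm_nonneg _) (cbF_nonneg _)

theorem conjTranspose_Δ (ξ : Fin n → ℝ) : (Δ ξ)ᴴ = Δ ξ := by
  rw [Δ, Matrix.diagonal_conjTranspose]
  exact congrArg _ (funext fun j => Complex.conj_ofReal (ξ j))

theorem conjTranspose_sqrt (P : Matrix (Fin n) (Fin n) ℂ) : (CFC.sqrt P)ᴴ = CFC.sqrt P :=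
  (Matrix.nonneg_iff_posSemidef.mp (CFC.sqrt_nonneg P)).isHermitian

namespace IsPolarDecomposition

variable {B W : Matrix (Fin m) (Fin n) ℂ} {P : Matrix (Fin n) (Fin n) ℂ}

theorem sqrt_mul_sqrt (h : IsPolarDecomposition B W P) : CFC.sqrt P * CFC.sqrt P = P :=
  CFC.sqrt_mul_sqrt_self P (Matrix.nonneg_iff_posSemidef.mpr h.pos)

/-- Since W W*W = W, the columns of 1 - W*W lie in ker W, which is ker P. -/
theorem mul_one_sub (h : IsPolarDecomposition B W P) : P * (1 - Wᴴ * W) = 0 := by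
  refine Matrix.ext_of_mulVec_single fun j => ?_
  rw [Matrix.zero_mulVec, ← Matrix.mulVec_mulVec, ← h.ker_eq, Matrix.mulVec_mulVec, Matrix.mul_sub,
    Matrix.mul_one, ← Matrix.mul_assoc, h.partialIsometry, sub_self, Matrix.zero_mulVec]

theorem sqrt_mul (h : IsPolarDecomposition B W P) : CFC.sqrt P * (Wᴴ * W) = CFC.sqrt P := by
  have h0 : CFC.sqrt P * (1 - Wᴴ * W) = 0 := by
    -- With Z = 1 - W*W, (P^{1/2}Z)*(P^{1/2}Z) = Z*PZ = 0.
    rw [← Matrix.conjTranspose_mul_self_eq_zero, Matrix.conjTranspose_mul, conjTranspose_sqrt,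
      mul_assoc, ← mul_assoc (CFC.sqrt P), h.sqrt_mul_sqrt, h.mul_one_sub, mul_zero]
  rw [mul_sub, mul_one, sub_eq_zero] at h0
  exact h0.symm

theorem norm_sqrt_mul_self (h : IsPolarDecomposition B W P) :
    ‖CFC.sqrt P‖ * ‖CFC.sqrt P‖ = ‖P‖ := by
  rw [← Matrix.l2_opNorm_conjTranspose_mul_self, conjTranspose_sqrt, h.sqrt_mul_sqrt]

/-- B*B = P W*W P = P², so the C*-identity applies. -/
theorem norm_eq (h : IsPolarDecomposition B W P) : ‖B‖ = ‖P‖ := by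
  have hP : P * (Wᴴ * W) = P := by
    have := h.mul_one_sub
    rw [mul_sub, mul_one, sub_eq_zero] at this
    exact this.symm
  rw [← mul_self_inj (norm_nonneg _) (norm_nonneg _), ← Matrix.l2_opNorm_conjTranspose_mul_self,
    ← Matrix.l2_opNorm_conjTranspose_mul_self, h.eq, Matrix.conjTranspose_mul,
    h.pos.isHermitian.eq, Matrix.mul_assoc, ← Matrix.mul_assoc Wᴴ, ← Matrix.mul_assoc, hP]

theorem norm_sqrt (h : IsPolarDecomposition B W P) : ‖CFC.sqrt P‖ = Real.sqrt ‖B‖ := by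
  rw [h.norm_eq, ← h.norm_sqrt_mul_self, Real.sqrt_mul_self (norm_nonneg _)]

/-- For T = P^{1/2}W*, TT* = P^{1/2} W*W P^{1/2} = P. -/
theorem norm_sqrt_mul_conjTranspose (h : IsPolarDecomposition B W P) :
    ‖CFC.sqrt P * Wᴴ‖ = Real.sqrt ‖B‖ := by
  rw [h.norm_eq, ← Matrix.l2_opNorm_conjTranspose,
    eq_comm, Real.sqrt_eq_iff_mul_self_eq (norm_nonneg _) (norm_nonneg _),
    ← Matrix.l2_opNorm_conjTranspose_mul_self, Matrix.conjTranspose_conjTranspose,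
    Matrix.conjTranspose_mul, Matrix.conjTranspose_conjTranspose, conjTranspose_sqrt,
    Matrix.mul_assoc, ← Matrix.mul_assoc Wᴴ, ← Matrix.mul_assoc, h.sqrt_mul, h.sqrt_mul_sqrt]

end IsPolarDecomposition

end CbMatrix

theorem mainTheorem7 (m n : ℕ) (X : Matrix (Fin m) (Fin n) ℂ)
    (η : Fin m → ℝ) (B : Matrix (Fin m) (Fin n) ℂ) (ξ : Fin n → ℝ)
    (hX : CbMatrix.IsCbBFactorization X η B ξ)
    (W : Matrix (Fin m) (Fin n) ℂ) (P : Matrix (Fin n) (Fin n) ℂ)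
    (hB : CbMatrix.IsPolarDecomposition B W P)
    (C : Matrix (Fin n) (Fin n) ℂ) (hC : C = CFC.sqrt P * CbMatrix.Δ ξ)
    (D : Matrix (Fin m) (Fin n) ℂ) (hD : D = CbMatrix.Δ η * W * CFC.sqrt P) :
    X = D * C ∧
    (CbMatrix.cbF Dᴴ = Real.sqrt (CbMatrix.cbB X) ∧
      CbMatrix.IsCbFFactorization Dᴴ (CFC.sqrt P * Wᴴ) η) ∧
    (CbMatrix.cbF C = Real.sqrt (CbMatrix.cbB X) ∧
      CbMatrix.IsCbFFactorization C (CFC.sqrt P) ξ) := by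
  have hXDC : X = D * C := by
    rw [hX.eq, hD, hC, hB.eq, Matrix.mul_assoc _ (CFC.sqrt P),
      ← Matrix.mul_assoc (CFC.sqrt P), hB.sqrt_mul_sqrt]
    simp only [Matrix.mul_assoc]
  have hDH : Dᴴ = CFC.sqrt P * Wᴴ * CbMatrix.Δ η := by
    rw [hD, Matrix.conjTranspose_mul, Matrix.conjTranspose_mul, CbMatrix.conjTranspose_sqrt,
      CbMatrix.conjTranspose_Δ, Matrix.mul_assoc]
  have hnS : ‖CFC.sqrt P‖ = Real.sqrt (CbMatrix.cbB X) := by rw [hB.norm_sqrt, hX.norm_eq]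
  have hnT : ‖CFC.sqrt P * Wᴴ‖ = Real.sqrt (CbMatrix.cbB X) := by
    rw [hB.norm_sqrt_mul_conjTranspose, hX.norm_eq]
  have hle : CbMatrix.cbB X ≤ CbMatrix.cbF Dᴴ * CbMatrix.cbF C := by
    have h := CbMatrix.cbB_mul_le (CFC.sqrt P * Wᴴ) hX.unit_left (CFC.sqrt P) hX.unit_right
    rwa [← hDH, ← hC, Matrix.conjTranspose_conjTranspose, ← hXDC] at h
  have hCle : CbMatrix.cbF C ≤ Real.sqrt (CbMatrix.cbB X) := by
    rw [hC, ← hnS]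
    exact CbMatrix.cbF_mul_diagonal_le _ hX.unit_right
  have hDle : CbMatrix.cbF Dᴴ ≤ Real.sqrt (CbMatrix.cbB X) := by
    rw [hDH, ← hnT]
    exact CbMatrix.cbF_mul_diagonal_le _ hX.unit_left
  have h0 : 0 ≤ CbMatrix.cbB X := hX.norm_eq ▸ norm_nonneg B
  have hsq := Real.mul_self_sqrt h0
  have hC0 := CbMatrix.cbF_nonneg C
  have hD0 := CbMatrix.cbF_nonneg Dᴴ
  have hCeq : CbMatrix.cbF C = Real.sqrt (CbMatrix.cbB X) := by
    refine le_antisymm hCle (not_lt.mp fun hlt => ?_)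
    -- If ‖C‖_cbF < s, then s > 0 and ‖D*‖_cbF ‖C‖_cbF ≤ s ‖C‖_cbF < s², a contradiction.
    nlinarith
  have hDeq : CbMatrix.cbF Dᴴ = Real.sqrt (CbMatrix.cbB X) := by
    refine le_antisymm hDle (not_lt.mp fun hlt => ?_)
    nlinarith
  exact ⟨hXDC, ⟨hDeq, hX.unit_left, hDH, hnT.trans hDeq.symm⟩,
    ⟨hCeq, hX.unit_right, hC, hnS.trans hCeq.symm⟩⟩
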